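/- Let $\Omega\subset\mathbb{R}^n$ be a bounded domain with smooth boundary, $T>0$, and let $H(r)=1$ for $r>0$, $H(r)=0$ for $r\le 0$. Let $u^0\in H^1_0(\Omega)$, $f\in L^2(\Omega)$ (independent of time) and $u^c\in H^2(\Omega)$ with $u^c\le 0$ on $\partial\Omega$ (that is, $\max(u^c,0)\in H^1_0(\Omega)$), and assume that $u^0>u^c$ a.e. in $\Omega$ and $\Delta u^c+f\le 0$ a.e. in $\Omega$. Put $\mathcal K=\{\varphi\in H^1_0(\Omega):\varphi\ge u^c \text{ a.e. in }\Omega\}$. All solutions below are functions $v\in L^2(0,T;H^1_0(\Omega)\cap H^2(\Omega))$ with $v_t\in L^2(0,T;L^2(\Omega))$, identified with their representatives in $C([0,T];L^2(\Omega))$, with $v(0)=u^0$. Such a $v$ is called a solution of (D) the degenerate problem, if for a.e. $t\in(0,T)$: $v_t-H(v-u^c)(\Delta v+f)=0$ a.e. in $\Omega$; (O) the parabolic obstacle problem, if $u^0\in\mathcal K$ and for a.e. $t\in(0,T)$: $v(t)\in\mathcal K$ and $\int_\Omega (v_t-\Delta v-f)(\varphi-v)\,dx\ge 0$ for all $\varphi\in\mathcal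 K$; (C) the complementarity system, if for a.e. $t\in(0,T)$: $v\ge u^c$, $v_t\ge\Delta v+f$ and $(v-u^c)(v_t-\Delta v-f)=0$ a.e. in $\Omega$. Let $u$ be a solution of (D). Then $u(t)\in\mathcal K$ (in particular $u(t)\ge u^c$ a.e. in $\Omega$) for every $t\in[0,T]$, and $u$ is a solution of (O) and of (C). Moreover, every solution $w$ of (O), and every solution $w$ of (C), satisfies $w(t)=u(t)$ for all $t\in[0,T]$; thus $u$ coincides for all times with the unique solution of (O) and of (C). In particular, any two solutions of (D) coincide on $[0,T]$. -/

import Mathlib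

open MeasureTheory Set
open scoped ContDiff

namespace DegenerateDiffusion

/-- The space `ℝⁿ` with its Euclidean norm and Lebesgue measure. -/
abbrev Space (n : ℕ) : Type := EuclideanSpace ℝ (Fin n)

/-- The real Hilbert space `L²(Ω)`. -/
abbrev L2 {n : ℕ} (Ω : Set (Space n)) : Type := Lp ℝ 2 (volume.restrict Ω)

/-- A bounded domain (nonempty, open, connected) of `ℝⁿ` with smooth boundary: near each of its
boundary points it is the strict sublevel set of a smooth function with nonvanishing gradient. -/
structure IsSmoothBoundedDomain {n : ℕ} (Ω : Set (Space n)) : Prop where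
  isOpen : IsOpen Ω
  isConnected : IsConnected Ω
  isBounded : Bornology.IsBounded Ω
  smooth_boundary : ∀ x ∈ frontier Ω, ∃ U : Set (Space n), IsOpen U ∧ x ∈ U ∧
    ∃ g : Space n → ℝ, ContDiff ℝ ∞ g ∧ (∀ y ∈ U, fderiv ℝ g y ≠ 0) ∧ g x = 0 ∧
      Ω ∩ U = {y ∈ U | g y < 0}

/-- Test functions: `φ ∈ C_c^∞(Ω)`. -/
structure IsTestFunction {n : ℕ} (Ω : Set (Space n)) (φ : Space n → ℝ) : Prop where
  smooth : ContDiff ℝ ∞ φ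
  compact : HasCompactSupport φ
  support_subset : tsupport φ ⊆ Ω

/-- The classical partial derivative `∂φ/∂xᵢ`. -/
noncomputable def partialDeriv {n : ℕ} (i : Fin n) (φ : Space n → ℝ) (x : Space n) : ℝ :=
  fderiv ℝ φ x (EuclideanSpace.single i (1 : ℝ))

/-- `g ∈ L²(Ω)` is the weak partial derivative `∂v/∂xᵢ` of `v ∈ L²(Ω)`. -/
def HasWeakPartial {n : ℕ} (Ω : Set (Space n)) (i : Fin n) (v g : L2 Ω) : Prop :=
  ∀ φ : Space n → ℝ, IsTestFunction Ω φ →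
    ∫ x in Ω, v x * partialDeriv i φ x = -∫ x in Ω, g x * φ x

open Classical in
/-- The weak partial derivative `∂v/∂xᵢ ∈ L²(Ω)`; the value is `0` if there is none in `L²(Ω)`. -/
noncomputable def weakPartial {n : ℕ} {Ω : Set (Space n)} (i : Fin n) (v : L2 Ω) : L2 Ω :=
  if h : ∃ g : L2 Ω, HasWeakPartial Ω i v g then h.choose else 0

/-- The Sobolev space `H¹(Ω)`. -/
def H1 {n : ℕ} (Ω : Set (Space n)) : Set (L2 Ω) :=
  {v | ∀ i : Fin n, ∃ g : L2 Ω, HasWeakPartial Ω i v g}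

/-- The Sobolev space `H²(Ω)`. -/
def H2 {n : ℕ} (Ω : Set (Space n)) : Set (L2 Ω) :=
  {v | v ∈ H1 Ω ∧ ∀ i : Fin n, weakPartial i v ∈ H1 Ω}

/-- The Sobolev space `H¹₀(Ω)`: the closure of `C_c^∞(Ω)` in `H¹(Ω)`. -/
def H10 {n : ℕ} (Ω : Set (Space n)) : Set (L2 Ω) :=
  {v | v ∈ H1 Ω ∧ ∀ ε : ℝ, 0 < ε → ∃ φ : Space n → ℝ, IsTestFunction Ω φ ∧
    eLpNorm (fun x => v x - φ x) 2 (volume.restrict Ω) ≤ ENNReal.ofReal ε ∧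
    ∀ i : Fin n, eLpNorm (fun x => weakPartial i v x - partialDeriv i φ x) 2
      (volume.restrict Ω) ≤ ENNReal.ofReal ε}

/-- The weak Laplacian `Δv = ∑ᵢ ∂²v/∂xᵢ²`, meaningful for `v ∈ H²(Ω)`. -/
noncomputable def laplacian {n : ℕ} {Ω : Set (Space n)} (v : L2 Ω) : L2 Ω :=
  ∑ i : Fin n, weakPartial i (weakPartial i v)

/-- For `v ∈ H¹(Ω)`: `v ≤ 0` on `∂Ω`, in the usual sense that `max(v, 0) ∈ H¹₀(Ω)`. -/
def NonposOnBoundary {n : ℕ} {Ω : Set (Space n)} (v : L2 Ω) : Prop :=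
  v ⊔ 0 ∈ H10 Ω

/-- The Heaviside function with `H(0) = 0`. -/
noncomputable def heaviside (r : ℝ) : ℝ := if 0 < r then 1 else 0

/-- `u ∈ L²(0,T; H¹₀(Ω) ∩ H²(Ω))`: almost every `u(t)` is in `H¹₀(Ω) ∩ H²(Ω)`, and `u` and its
weak space derivatives up to second order are in the Bochner space `L²(0,T; L²(Ω))`. -/
structure MemL2H10H2 {n : ℕ} (Ω : Set (Space n)) (T : ℝ) (u : ℝ → L2 Ω) : Prop where
  mem : ∀ᵐ t ∂volume.restrict (Ioo 0 T), u t ∈ H10 Ω ∧ u t ∈ H2 Ω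
  memLp : MemLp u 2 (volume.restrict (Ioo 0 T))
  memLp_partial : ∀ i : Fin n,
    MemLp (fun t => weakPartial i (u t)) 2 (volume.restrict (Ioo 0 T))
  memLp_partial_partial : ∀ i j : Fin n,
    MemLp (fun t => weakPartial i (weakPartial j (u t))) 2 (volume.restrict (Ioo 0 T))

/-- `u_t = v` with `v ∈ L²(0,T; L²(Ω))`, where `u : [0,T] → L²(Ω)` is the (absolutely) continuous
representative: `u(t) = u(0) + ∫₀ᵗ v(s) ds` for all `t ∈ [0,T]`, as a Bochner integral. -/
structure HasTimeDeriv {n : ℕ} {Ω : Set (Space n)} (T : ℝ) (u v : ℝ → L2 Ω) : Prop where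
  memLp : MemLp v 2 (volume.restrict (Ioo 0 T))
  eq_integral : ∀ t ∈ Icc 0 T, u t = u 0 + ∫ s in (0 : ℝ)..t, v s

/-- The convex set `𝒦 = {φ ∈ H¹₀(Ω) : φ ≥ uc in Ω}`. -/
def obstacleSet {n : ℕ} {Ω : Set (Space n)} (uc : L2 Ω) : Set (L2 Ω) :=
  {φ | φ ∈ H10 Ω ∧ ∀ᵐ x ∂volume.restrict Ω, uc x ≤ φ x}

/-- `u` solves the degenerate problem `u_t - H(u - uc)(Δu + f) = 0`, `u(0) = u0`,
`u = 0` on `∂Ω`, on `(0,T)`. -/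
def SolvesDegenerate {n : ℕ} {Ω : Set (Space n)} (T : ℝ) (f uc u0 : L2 Ω) (u : ℝ → L2 Ω) :
    Prop :=
  MemL2H10H2 Ω T u ∧ ∃ ut : ℝ → L2 Ω, HasTimeDeriv T u ut ∧
    (∀ᵐ t ∂volume.restrict (Ioo 0 T), ∀ᵐ x ∂volume.restrict Ω,
      ut t x - heaviside (u t x - uc x) * (laplacian (u t) x + f x) = 0) ∧
    u 0 = u0

/-- `w` solves the parabolic obstacle problem (variational inequality on `𝒦`) on `(0,T)`. -/
def SolvesObstacle {n : ℕ} {Ω : Set (Space n)} (T : ℝ) (f uc u0 : L2 Ω) (w : ℝ → L2 Ω) :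
    Prop :=
  MemL2H10H2 Ω T w ∧ ∃ wt : ℝ → L2 Ω, HasTimeDeriv T w wt ∧
    (∀ᵐ t ∂volume.restrict (Ioo 0 T), w t ∈ obstacleSet uc ∧ ∀ φ ∈ obstacleSet uc,
      0 ≤ ∫ x in Ω, (wt t x - laplacian (w t) x - f x) * (φ x - w t x)) ∧
    w 0 = u0 ∧ u0 ∈ obstacleSet uc

/-- `w` solves the complementarity system of the parabolic obstacle problem on `(0,T)`. -/
def SolvesComplementarity {n : ℕ} {Ω : Set (Space n)} (T : ℝ) (f uc u0 : L2 Ω)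
    (w : ℝ → L2 Ω) : Prop :=
  MemL2H10H2 Ω T w ∧ ∃ wt : ℝ → L2 Ω, HasTimeDeriv T w wt ∧
    (∀ᵐ t ∂volume.restrict (Ioo 0 T), ∀ᵐ x ∂volume.restrict Ω,
      uc x ≤ w t x ∧ laplacian (w t) x + f x ≤ wt t x ∧
      (w t x - uc x) * (wt t x - laplacian (w t) x - f x) = 0) ∧
    w 0 = u0

end DegenerateDiffusion

open DegenerateDiffusion

/-!
Write `z⁻` for the negative part of `z`. Where `u ≤ uc` the degenerate equation gives `u_t = 0`, so
`‖(u(t) - uc)⁻‖²` has derivative zero and keeps its initial value `0`: the solution stays above the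
obstacle (`SolvesDegenerate.obstacle_le`). Where `u > uc` the equation is `u_t = Δu + f`. On the
contact set `{u = uc}` one has `u_t = 0`, and applying Stampacchia's theorem twice to `u - uc` gives
`Δu = Δuc` there, whence `Δu + f = Δuc + f ≤ 0 = u_t`. So `u` solves the complementarity system, and
every solution of that system solves the variational inequality. Two solutions of the latter are
compared by testing each with the other: by Green's formula,
`d/dt ‖u - w‖² / 2 ≤ -‖∇(u - w)‖² ≤ 0`, which gives all the uniqueness statements.

Three ingredients are developed here.

* Stampacchia's theorem (`HasWeakPartial.ae_eq_zero`): `∂ᵢv = 0` almost everywhere on `{v = 0}`.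
  Locally `v(x + h eᵢ) - v(x) = ∫₀ʰ ∂ᵢv(x + s eᵢ) ds`, and for small `h` most points `x` of a set
  `Y ⊆ {v = 0}` have `x + h eᵢ ∈ Y`, so that the left-hand side vanishes on most of `Y`. Dividing by
  `h` and letting `h → 0`, with the continuity of translations in `L²`, gives `∫_Y ∂ᵢv = 0`.
* Dissipation of convex functionals along curves with derivative in `L²` (`le_of_inner_nonpos`). The
  subgradient inequality bounds the increments of the functional by `(t - s) ∫_s^t ‖z'‖²`, and such
  bounds add up to `0` over fine partitions, so that no chain rule is needed.
* `u(t) ∈ H¹₀(Ω)` for every `t` rather than almost every `t` (`mem_H10_of_hasTimeDeriv`). By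
  convexity of the Dirichlet energy `G` and Green's formula,
  `G(t) - G(t - h) ≤ h ‖Δu(t)‖² + ∫_{t-h}^t ‖u_t‖²`. Averaging over time bounds `G` along times
  tending to any given `t`, and `H¹₀(Ω)` is closed under `L²`-limits with bounded gradients, by weak
  compactness of balls in Hilbert space (`mem_H10_of_tendsto`).
-/

namespace DegenerateDiffusion

variable {n : ℕ} {Ω : Set (Space n)}

/-! ### Test functions and weak derivatives -/

lemma IsTestFunction.memLp {φ : Space n → ℝ} (h : IsTestFunction Ω φ) (μ : Measure (Space n))
    [IsFiniteMeasureOnCompacts μ] : MemLp φ 2 μ :=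
  h.smooth.continuous.memLp_of_hasCompactSupport h.compact

lemma contDiff_partialDeriv {φ : Space n → ℝ} (h : ContDiff ℝ ∞ φ) (i : Fin n) :
    ContDiff ℝ ∞ (partialDeriv i φ) :=
  (h.fderiv_right (m := ∞) (by simp)).clm_apply contDiff_const

lemma IsTestFunction.partialDeriv {φ : Space n → ℝ} (h : IsTestFunction Ω φ) (i : Fin n) :
    IsTestFunction Ω (partialDeriv i φ) where
  smooth := contDiff_partialDeriv h.smooth i
  compact := h.compact.fderiv_apply (𝕜 := ℝ) _
  support_subset := (tsupport_fderiv_apply_subset ℝ _).trans h.support_subset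

lemma IsTestFunction.add {φ ψ : Space n → ℝ} (hφ : IsTestFunction Ω φ) (hψ : IsTestFunction Ω ψ) :
    IsTestFunction Ω (φ + ψ) where
  smooth := hφ.smooth.add hψ.smooth
  compact := hφ.compact.add hψ.compact
  support_subset := (tsupport_add φ ψ).trans (union_subset hφ.support_subset hψ.support_subset)

lemma IsTestFunction.const_smul {φ : Space n → ℝ} (hφ : IsTestFunction Ω φ) (c : ℝ) :
    IsTestFunction Ω (c • φ) where
  smooth := hφ.smooth.const_smul c
  compact := hφ.compact.smul_left (f := fun _ => c)
  support_subset := (tsupport_smul_subset_right (fun _ => c) φ).trans hφ.support_subset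

lemma isTestFunction_zero : IsTestFunction Ω (0 : Space n → ℝ) where
  smooth := contDiff_const
  compact := HasCompactSupport.zero
  support_subset := by simp

lemma partialDeriv_add {φ ψ : Space n → ℝ} (hφ : ContDiff ℝ ∞ φ) (hψ : ContDiff ℝ ∞ ψ)
    (i : Fin n) : partialDeriv i (φ + ψ) = partialDeriv i φ + partialDeriv i ψ := by
  ext x
  simp only [DegenerateDiffusion.partialDeriv, Pi.add_apply]
  rw [fderiv_add (hφ.differentiable (by simp) x) (hψ.differentiable (by simp) x)]
  rfl

lemma partialDeriv_const_smul {φ : Space n → ℝ} (hφ : ContDiff ℝ ∞ φ) (c : ℝ)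
    (i : Fin n) : partialDeriv i (c • φ) = c • partialDeriv i φ := by
  ext x
  simp only [DegenerateDiffusion.partialDeriv, Pi.smul_apply]
  rw [fderiv_const_smul (hφ.differentiable (by simp) x)]
  rfl

/-- The class in `L²(Ω)` of a test function. -/
noncomputable def IsTestFunction.toL2 {φ : Space n → ℝ} (h : IsTestFunction Ω φ) : L2 Ω :=
  (h.memLp (volume.restrict Ω)).toLp φ

lemma IsTestFunction.toL2_congr {φ ψ : Space n → ℝ} (e : φ = ψ) (hφ : IsTestFunction Ω φ)
    (hψ : IsTestFunction Ω ψ) : hφ.toL2 = hψ.toL2 := by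
  subst e; rfl

lemma eLpNorm_coeFn_sub_toL2 (v : L2 Ω) {φ : Space n → ℝ} (h : IsTestFunction Ω φ) :
    eLpNorm (v - h.toL2 : L2 Ω) 2 (volume.restrict Ω)
      = eLpNorm (fun x => v x - φ x) 2 (volume.restrict Ω) := by
  refine eLpNorm_congr_ae ?_
  filter_upwards [Lp.coeFn_sub v h.toL2, (h.memLp (volume.restrict Ω)).coeFn_toLp] with x hx hx'
  rw [hx, Pi.sub_apply, IsTestFunction.toL2, hx']

lemma L2.inner_eq_integral_mul (v w : L2 Ω) : inner ℝ v w = ∫ x in Ω, v x * w x := by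
  rw [MeasureTheory.L2.inner_def]
  exact integral_congr_ae (.of_forall fun x => by simp [mul_comm])

lemma inner_toL2 (v : L2 Ω) {φ : Space n → ℝ} (h : IsTestFunction Ω φ) :
    inner ℝ v h.toL2 = ∫ x in Ω, v x * φ x := by
  rw [L2.inner_eq_integral_mul]
  refine integral_congr_ae ?_
  filter_upwards [(h.memLp (volume.restrict Ω)).coeFn_toLp] with x hx
  rw [IsTestFunction.toL2, hx]

lemma hasWeakPartial_iff {i : Fin n} {v g : L2 Ω} :
    HasWeakPartial Ω i v g ↔ ∀ (φ : Space n → ℝ) (h : IsTestFunction Ω φ),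
      inner ℝ v (h.partialDeriv i).toL2 = -inner ℝ g h.toL2 := by
  simp only [HasWeakPartial, inner_toL2]

lemma HasWeakPartial.sub {i : Fin n} {v g w k : L2 Ω} (hv : HasWeakPartial Ω i v g)
    (hw : HasWeakPartial Ω i w k) : HasWeakPartial Ω i (v - w) (g - k) := by
  rw [hasWeakPartial_iff] at *
  intro φ h
  rw [inner_sub_left, inner_sub_left, hv φ h, hw φ h]
  ring

/-- Functions in `L²(Ω)` that are orthogonal to all test functions vanish. -/
lemma eq_of_forall_inner_toL2 (hΩ : IsOpen Ω) {g k : L2 Ω}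
    (h : ∀ (φ : Space n → ℝ) (hφ : IsTestFunction Ω φ), inner ℝ g hφ.toL2 = inner ℝ k hφ.toL2) :
    g = k := by
  rw [← sub_eq_zero]
  have key : ∀ᵐ x ∂volume, x ∈ Ω → (g - k) x = 0 := by
    refine hΩ.ae_eq_zero_of_integral_contDiff_smul_eq_zero ?_ ?_
    · refine LocallyIntegrableOn.mono_set ?_ subset_rfl
      rw [locallyIntegrableOn_iff hΩ.isLocallyClosed]
      intro K hK hKc
      have h1 : MemLp (g - k : L2 Ω) 2 (volume.restrict K) :=
        (Lp.memLp (g - k)).mono_measure (Measure.restrict_mono hK le_rfl)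
      have : IsFiniteMeasure (volume.restrict K) := ⟨by simpa using hKc.measure_lt_top⟩
      exact h1.integrable (by norm_num)
    · intro φ h1 h2 h3
      have hφ : IsTestFunction Ω φ := ⟨h1, h2, h3⟩
      have h4 : inner ℝ (g - k) hφ.toL2 = 0 := by rw [inner_sub_left, h φ hφ, sub_self]
      rw [inner_toL2] at h4
      rw [← h4, setIntegral_eq_integral_of_forall_compl_eq_zero]
      · simp [mul_comm]
      · intro x hx
        rw [image_eq_zero_of_notMem_tsupport (fun hx' => hx (h3 hx')), mul_zero]
  rw [Lp.eq_zero_iff_ae_eq_zero]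
  exact (ae_restrict_iff' hΩ.measurableSet).2 key

lemma HasWeakPartial.unique (hΩ : IsOpen Ω) {i : Fin n} {v g k : L2 Ω}
    (hg : HasWeakPartial Ω i v g) (hk : HasWeakPartial Ω i v k) : g = k := by
  rw [hasWeakPartial_iff] at *
  refine eq_of_forall_inner_toL2 hΩ fun φ hφ => ?_
  linarith [hg φ hφ, hk φ hφ]

lemma hasWeakPartial_weakPartial {i : Fin n} {v : L2 Ω} (hv : v ∈ H1 Ω) :
    HasWeakPartial Ω i v (weakPartial i v) := by
  rw [weakPartial, dif_pos (hv i)]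
  exact (hv i).choose_spec

lemma HasWeakPartial.weakPartial_eq (hΩ : IsOpen Ω) {i : Fin n} {v g : L2 Ω}
    (hg : HasWeakPartial Ω i v g) : weakPartial i v = g := by
  have h : ∃ g : L2 Ω, HasWeakPartial Ω i v g := ⟨g, hg⟩
  rw [weakPartial, dif_pos h]
  exact h.choose_spec.unique hΩ hg

/-! ### The graph of the gradient and `H¹₀(Ω)` -/

/-- The Hilbert space of pairs `(v, (gᵢ)ᵢ)` in which the graph of the gradient lives; the index
`none` is the function and `some i` its `i`-th partial derivative. -/
abbrev GraphSpace {n : ℕ} (Ω : Set (Space n)) : Type := PiLp 2 (fun _ : Option (Fin n) => L2 Ω)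

/-- The point `(φ, ∇φ)` of the graph space, for a test function `φ`. -/
noncomputable def IsTestFunction.graph {φ : Space n → ℝ} (h : IsTestFunction Ω φ) : GraphSpace Ω :=
  WithLp.toLp 2 fun o => o.elim h.toL2 fun i => (h.partialDeriv i).toL2

/-- The submodule of all `(φ, ∇φ)` with `φ` a test function. -/
noncomputable def testGraph {n : ℕ} (Ω : Set (Space n)) : Submodule ℝ (GraphSpace Ω) where
  carrier := {z | ∃ (φ : Space n → ℝ) (h : IsTestFunction Ω φ), z = h.graph}
  zero_mem' := by
    refine ⟨0, isTestFunction_zero, ?_⟩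
    ext1 o
    cases o with
    | none => rfl
    | some i =>
      symm
      refine (Lp.eq_zero_iff_ae_eq_zero).2
        ((MemLp.coeFn_toLp (((isTestFunction_zero (Ω := Ω)).partialDeriv i).memLp _)).trans
          (.of_forall fun x => ?_))
      simp [DegenerateDiffusion.partialDeriv]
  add_mem' := by
    rintro _ _ ⟨φ, hφ, rfl⟩ ⟨ψ, hψ, rfl⟩
    refine ⟨φ + ψ, hφ.add hψ, ?_⟩
    ext1 o
    cases o with
    | none => rfl
    | some i =>
      exact (IsTestFunction.toL2_congr (partialDeriv_add hφ.smooth hψ.smooth i)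
        ((hφ.add hψ).partialDeriv i) ((hφ.partialDeriv i).add (hψ.partialDeriv i))).symm
  smul_mem' := by
    rintro c _ ⟨φ, hφ, rfl⟩
    refine ⟨c • φ, hφ.const_smul c, ?_⟩
    ext1 o
    cases o with
    | none => rfl
    | some i =>
      exact (IsTestFunction.toL2_congr (partialDeriv_const_smul hφ.smooth c i)
        ((hφ.const_smul c).partialDeriv i) ((hφ.partialDeriv i).const_smul c)).symm

lemma mem_testGraph {z : GraphSpace Ω} :
    z ∈ testGraph Ω ↔ ∃ (φ : Space n → ℝ) (h : IsTestFunction Ω φ), z = h.graph := by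
  exact Iff.rfl

/-- Integration by parts for two test functions. -/
lemma IsTestFunction.inner_partialDeriv {φ ψ : Space n → ℝ} (hφ : IsTestFunction Ω φ)
    (hψ : IsTestFunction Ω ψ) (i : Fin n) :
    inner ℝ hφ.toL2 (hψ.partialDeriv i).toL2 = -inner ℝ (hφ.partialDeriv i).toL2 hψ.toL2 := by
  have aux : ∀ {φ ψ : Space n → ℝ} (hφ : IsTestFunction Ω φ) (hψ : IsTestFunction Ω ψ),
      inner ℝ hφ.toL2 hψ.toL2 = ∫ x, φ x * ψ x := by
    intro φ ψ hφ hψ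
    rw [inner_toL2]
    refine Eq.trans ?_ (setIntegral_eq_integral_of_forall_compl_eq_zero (s := Ω) ?_)
    · refine integral_congr_ae ?_
      filter_upwards [(hφ.memLp (volume.restrict Ω)).coeFn_toLp] with x hx
      rw [IsTestFunction.toL2, hx]
    · intro x hx
      rw [image_eq_zero_of_notMem_tsupport (fun hx' => hx (hψ.support_subset hx')), mul_zero]
  have hint : ∀ {φ ψ : Space n → ℝ} (hφ : IsTestFunction Ω φ) (hψ : IsTestFunction Ω ψ),
      Integrable (fun x => φ x * ψ x) volume := fun hφ hψ =>
    (hφ.memLp (volume : Measure (Space n))).integrable_mul (hψ.memLp volume)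
  rw [aux, aux]
  exact integral_mul_fderiv_eq_neg_fderiv_mul_of_integrable (hint (hφ.partialDeriv i) hψ)
    (hint hφ (hψ.partialDeriv i)) (hint hφ hψ) (fun x _ => hφ.smooth.differentiable (by simp) x)
    (fun x _ => hψ.smooth.differentiable (by simp) x)

/-- The second component of a limit of points `(φ, ∇φ)` is the weak gradient of the first. -/
lemma hasWeakPartial_of_mem_closure {z : GraphSpace Ω} (hz : z ∈ (testGraph Ω).topologicalClosure)
    (i : Fin n) : HasWeakPartial Ω i (z none) (z (some i)) := by
  rw [hasWeakPartial_iff]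
  intro ψ hψ
  rw [← SetLike.mem_coe, Submodule.topologicalClosure_coe] at hz
  have hcl : IsClosed {z : GraphSpace Ω |
      inner ℝ (z none) (hψ.partialDeriv i).toL2 = -inner ℝ (z (some i)) hψ.toL2} := by
    refine isClosed_eq ?_ ?_ <;> fun_prop
  refine closure_minimal ?_ hcl hz
  intro z hz
  obtain ⟨φ, hφ, rfl⟩ := mem_testGraph.1 hz
  exact hφ.inner_partialDeriv hψ i

/-- The function component of a limit of points `(φ, ∇φ)` is in `H¹₀(Ω)`. -/
lemma mem_H10_of_mem_closure (hΩ : IsOpen Ω) {z : GraphSpace Ω}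
    (hz : z ∈ (testGraph Ω).topologicalClosure) : z none ∈ H10 Ω := by
  refine ⟨fun i => ⟨_, hasWeakPartial_of_mem_closure hz i⟩, fun ε hε => ?_⟩
  obtain ⟨y, hy, hyz⟩ := Metric.mem_closure_iff.1 hz ε hε
  obtain ⟨φ, hφ, rfl⟩ := mem_testGraph.1 hy
  have hcomp : ∀ o, ‖z o - hφ.graph o‖ ≤ ε := fun o => by
    refine le_trans ?_ (dist_eq_norm z hφ.graph ▸ hyz.le)
    exact PiLp.norm_apply_le (z - hφ.graph) o
  have hL : ∀ (v : L2 Ω) (ψ : Space n → ℝ) (hψ : IsTestFunction Ω ψ), ‖v - hψ.toL2‖ ≤ ε →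
      eLpNorm (fun x => v x - ψ x) 2 (volume.restrict Ω) ≤ ENNReal.ofReal ε := by
    intro v ψ hψ h
    rw [← eLpNorm_coeFn_sub_toL2 v hψ, ← ENNReal.ofReal_toReal (Lp.eLpNorm_ne_top _)]
    exact ENNReal.ofReal_le_ofReal h
  refine ⟨φ, hφ, hL _ _ hφ (hcomp none), fun i => ?_⟩
  rw [(hasWeakPartial_of_mem_closure hz i).weakPartial_eq hΩ]
  exact hL _ _ (hφ.partialDeriv i) (hcomp (some i))

/-- The point `(v, ∇v)` of the graph space, with `∇v` the weak gradient. -/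
noncomputable def weakGraph (v : L2 Ω) : GraphSpace Ω :=
  WithLp.toLp 2 fun o => o.elim v fun i => weakPartial i v

lemma weakGraph_mem_closure {v : L2 Ω} (hv : v ∈ H10 Ω) :
    weakGraph v ∈ (testGraph Ω).topologicalClosure := by
  rw [← SetLike.mem_coe, Submodule.topologicalClosure_coe, Metric.mem_closure_iff]
  intro ε hε
  set N : ℝ := (Fintype.card (Option (Fin n)) : ℝ) with hN
  have hN0 : 0 ≤ N := by positivity
  obtain ⟨φ, hφ, h0, h1⟩ := hv.2 (ε / (N + 1)) (by positivity)
  refine ⟨hφ.graph, mem_testGraph.2 ⟨φ, hφ, rfl⟩, ?_⟩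
  have hL : ∀ (v : L2 Ω) (ψ : Space n → ℝ) (hψ : IsTestFunction Ω ψ),
      eLpNorm (fun x => v x - ψ x) 2 (volume.restrict Ω) ≤ ENNReal.ofReal (ε / (N + 1)) →
      ‖v - hψ.toL2‖ ≤ ε / (N + 1) := by
    intro v ψ hψ h
    rw [Lp.norm_def, eLpNorm_coeFn_sub_toL2]
    exact ENNReal.toReal_le_of_le_ofReal (by positivity) h
  have hcomp : ∀ o, ‖(weakGraph v - hφ.graph) o‖ ≤ ε / (N + 1) := fun o => by
    cases o with
    | none => exact hL _ _ hφ h0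
    | some i => exact hL _ _ (hφ.partialDeriv i) (h1 i)
  -- the Euclidean norm of the graph space is at most the sum of the norms of the components
  have hsum : ‖weakGraph v - hφ.graph‖ ≤ ∑ o, ‖(weakGraph v - hφ.graph) o‖ := by
    rw [PiLp.norm_eq_of_L2]
    refine Real.sqrt_le_iff.2 ⟨by positivity, ?_⟩
    exact Finset.sum_sq_le_sq_sum_of_nonneg fun _ _ => norm_nonneg _
  rw [dist_eq_norm]
  calc _ ≤ ∑ o, ‖(weakGraph v - hφ.graph) o‖ := hsum
    _ ≤ ∑ o : Option (Fin n), ε / (N + 1) := Finset.sum_le_sum fun o _ => hcomp o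
    _ = N * (ε / (N + 1)) := by simp [hN]
    _ < ε := by
      rw [mul_div_assoc', div_lt_iff₀ (by positivity)]
      nlinarith

/-- Green's formula: `∫ Δy z = -∫ ∇y · ∇z` for `y ∈ H²(Ω)` and `z ∈ H¹₀(Ω)`. -/
lemma inner_laplacian {y z : L2 Ω} (hy : y ∈ H2 Ω) (hz : z ∈ H10 Ω) :
    inner ℝ (laplacian y) z = -∑ i, inner ℝ (weakPartial i y) (weakPartial i z) := by
  have hcl : IsClosed {z : GraphSpace Ω | ∀ i, inner ℝ (weakPartial i (weakPartial i y)) (z none)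
      = -inner ℝ (weakPartial i y) (z (some i))} := by
    simp only [ofPred_forall]
    refine isClosed_iInter fun i => isClosed_eq ?_ ?_ <;> fun_prop
  have hmem := weakGraph_mem_closure hz
  rw [← SetLike.mem_coe, Submodule.topologicalClosure_coe] at hmem
  have key := closure_minimal (fun z hz => ?_) hcl hmem
  · rw [laplacian, sum_inner, ← Finset.sum_neg_distrib]
    exact Finset.sum_congr rfl fun i _ => key i
  · obtain ⟨φ, hφ, rfl⟩ := mem_testGraph.1 hz
    intro i
    have h := hasWeakPartial_iff.1 (hasWeakPartial_weakPartial (i := i) (hy.2 i)) φ hφ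
    change inner ℝ (weakPartial i (weakPartial i y)) hφ.toL2
      = -inner ℝ (weakPartial i y) (hφ.partialDeriv i).toL2
    rw [h, neg_neg]

/-! ### Weak closedness of `H¹₀(Ω)` -/

/-- Weak sequential closedness of a closed subspace `S` of a Hilbert space: if the images under a
bounded operator `A` of a bounded sequence of `S` converge, the limit is in `A S`. -/
lemma exists_mem_of_tendsto_of_bounded {E F : Type*} [NormedAddCommGroup E] [InnerProductSpace ℝ E]
    [CompleteSpace E] [NormedAddCommGroup F] [InnerProductSpace ℝ F] [CompleteSpace F]
    (S : Submodule ℝ E) (hS : IsClosed (S : Set E)) (A : E →L[ℝ] F) {z : ℕ → E} {M : ℝ} {v : F}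
    (hz : ∀ k, z k ∈ S) (hM : ∀ k, ‖z k‖ ≤ M)
    (hv : Filter.Tendsto (fun k => A (z k)) Filter.atTop (nhds v)) : ∃ x ∈ S, A x = v := by
  have hcpt := WeakDual.isCompact_closedBall (𝕜 := ℝ) (E := E) 0 M
  set L : ℕ → WeakDual ℝ E := fun k =>
    StrongDual.toWeakDual (InnerProductSpace.toDual ℝ E (z k)) with hL
  obtain ⟨l, -, hl⟩ := isCompact_iff_ultrafilter_le_nhds.1 hcpt
    ((Filter.hyperfilter ℕ).map L) (by
      rw [Filter.le_principal_iff]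
      refine Filter.mem_map.2 (Filter.univ_mem' fun k => ?_)
      simpa [hL] using hM k)
  set x : E := (InnerProductSpace.toDual ℝ E).symm (WeakDual.toStrongDual l) with hx
  have hlim : ∀ y : E, Filter.Tendsto (fun k => inner ℝ (z k) y) (Filter.hyperfilter ℕ)
      (nhds (inner ℝ x y)) := by
    intro y
    have h1 : inner ℝ x y = l y := by
      rw [hx, InnerProductSpace.toDual_symm_apply]; rfl
    rw [h1]
    exact ((WeakDual.eval_continuous y).tendsto l).comp hl
  have hle : (Filter.hyperfilter ℕ : Filter ℕ) ≤ Filter.atTop := Nat.hyperfilter_le_atTop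
  refine ⟨x, ?_, ?_⟩
  · have : S.HasOrthogonalProjection := by
      have : CompleteSpace S := hS.completeSpace_coe
      infer_instance
    rw [← S.orthogonal_orthogonal, Submodule.mem_orthogonal']
    intro y hy
    refine tendsto_nhds_unique (hlim y) ?_
    simp only [(Submodule.mem_orthogonal S y).1 hy _ (hz _)]
    exact tendsto_const_nhds
  · refine ext_inner_right ℝ fun y => ?_
    have h2 := hlim (A.adjoint y)
    simp only [ContinuousLinearMap.adjoint_inner_right] at h2
    exact tendsto_nhds_unique h2 (((hv.inner tendsto_const_nhds)).mono_left hle)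

/-- An `L²`-limit of a sequence of `H¹₀(Ω)` with bounded gradients is in `H¹₀(Ω)`. -/
lemma mem_H10_of_tendsto (hΩ : IsOpen Ω) {w : ℕ → L2 Ω} {M : ℝ} {v : L2 Ω}
    (hw : ∀ k, w k ∈ H10 Ω) (hM : ∀ k, ∑ i, ‖weakPartial i (w k)‖ ^ 2 ≤ M)
    (hv : Filter.Tendsto w Filter.atTop (nhds v)) : v ∈ H10 Ω := by
  obtain ⟨B, hB⟩ := (Metric.isBounded_range_of_tendsto w hv).exists_norm_le
  obtain ⟨x, hx, hxv⟩ := exists_mem_of_tendsto_of_bounded (testGraph Ω).topologicalClosure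
    (testGraph Ω).isClosed_topologicalClosure
    (PiLp.proj 2 (fun _ : Option (Fin n) => L2 Ω) none (𝕜 := ℝ)) (z := fun k => weakGraph (w k))
    (M := √(B ^ 2 + M)) (fun k => weakGraph_mem_closure (hw k)) (fun k => by
      rw [PiLp.norm_eq_of_L2, Fintype.sum_option]
      refine Real.sqrt_le_sqrt (add_le_add ?_ (hM k))
      exact pow_le_pow_left₀ (norm_nonneg _) (hB _ (mem_range_self k)) 2) hv
  rw [← hxv]
  exact mem_H10_of_mem_closure hΩ hx

/-! ### Translations in `L²(ℝⁿ)` and Stampacchia's theorem -/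

/-- The real Hilbert space `L²(ℝⁿ)`. -/
abbrev L2Space (n : ℕ) : Type := Lp ℝ 2 (volume : Measure (Space n))

/-- The translate `x ↦ f (x + s e)` of a function `f ∈ L²(ℝⁿ)`. -/
noncomputable def translate (e : Space n) (s : ℝ) (f : L2Space n) : L2Space n :=
  DomAddAct.mk (s • e) +ᵥ f

lemma continuous_translate (e : Space n) (f : L2Space n) :
    Continuous fun s => translate e s f := by
  have h : Continuous fun s : ℝ => DomAddAct.mk (s • e) :=
    DomAddAct.continuous_mk.comp (by fun_prop)
  have : Fact ((2 : ENNReal) ≠ ⊤) := ⟨ENNReal.ofNat_ne_top⟩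
  exact h.vadd continuous_const

lemma translate_zero (e : Space n) (f : L2Space n) : translate e 0 f = f := by
  rw [translate, zero_smul]
  exact zero_vadd _ f

lemma coeFn_translate (e : Space n) (s : ℝ) (f : L2Space n) :
    translate e s f =ᵐ[volume] fun x => f (s • e + x) :=
  DomAddAct.vadd_Lp_ae_eq _ f

lemma inner_translate (e : Space n) (s : ℝ) (f : L2Space n) {ψ : Space n → ℝ}
    (hψ : MemLp ψ 2 volume) :
    inner ℝ (translate e s f) (hψ.toLp ψ) = ∫ x, f x * ψ (x - s • e) := by
  rw [MeasureTheory.L2.inner_def,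
    ← integral_add_right_eq_self (fun x => f x * ψ (x - s • e)) (s • e)]
  refine integral_congr_ae ?_
  filter_upwards [coeFn_translate e s f, hψ.coeFn_toLp] with x hx hx'
  rw [hx, hx']
  simp [mul_comm, add_comm]

/-- The integral is the convolution of `f` with `x ↦ ψ (-x)` at the point `s e`, which is
differentiable because `ψ` is smooth with compact support. -/
lemma hasDerivAt_integral_mul_translate (e : Space n) (f : L2Space n) {ψ : Space n → ℝ}
    (hψ : ContDiff ℝ ∞ ψ) (hc : HasCompactSupport ψ) (s : ℝ) :
    HasDerivAt (fun s : ℝ => ∫ x, f x * ψ (x - s • e))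
      (-∫ x, f x * fderiv ℝ ψ (x - s • e) e) s := by
  set η : Space n → ℝ := fun x => ψ (-x) with hη
  have hf : LocallyIntegrable f volume :=
    (Lp.memLp f).locallyIntegrable (by norm_num)
  have hηs : ContDiff ℝ 1 η := (hψ.comp contDiff_neg).of_le (by simp)
  have hηc : HasCompactSupport η := hc.comp_homeomorph (Homeomorph.neg (Space n))
  have h1 := hηc.hasFDerivAt_convolution_right (ContinuousLinearMap.mul ℝ ℝ) hf hηs (s • e)
  have h2 : HasDerivAt (fun s : ℝ => s • e) e s := by
    simpa using (hasDerivAt_id s).smul_const e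
  have h3 := h1.comp_hasDerivAt s h2
  have h4 : (convolution f η (ContinuousLinearMap.mul ℝ ℝ) volume ∘ fun s : ℝ => s • e)
      = fun s : ℝ => ∫ x, f x * ψ (x - s • e) := by
    ext s
    simp [convolution_def, hη]
  rw [h4] at h3
  refine h3.congr_deriv ?_
  rw [convolution_precompR_apply _ hf (hηc.fderiv (𝕜 := ℝ)) (hηs.continuous_fderiv (by simp)),
    convolution_def, ← integral_neg]
  congr 1
  ext x
  have h5 : fderiv ℝ η (s • e - x) e = -fderiv ℝ ψ (x - s • e) e := by
    have h6 : HasFDerivAt η ((fderiv ℝ ψ (-(s • e - x))).comp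
        (-ContinuousLinearMap.id ℝ (Space n))) (s • e - x) :=
      ((hψ.differentiable (by simp) _).hasFDerivAt).comp _ (hasFDerivAt_id _).neg
    rw [h6.fderiv]
    simp
  simp [h5]

/-- Fundamental theorem of calculus along the direction `e` for weak derivatives: if `g` is the
weak derivative of `f` in the direction `e`, as far as this is seen by test functions supported in
the translates `U + s e` with `0 ≤ s ≤ h`, then `f (x + h e) - f x = ∫₀ʰ g (x + s e) ds` for almost
every `x ∈ U`. -/
lemma translate_sub_ae_eq (e : Space n) {U : Set (Space n)} (hU : IsOpen U) (f g : L2Space n)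
    {h : ℝ} (hh : 0 ≤ h)
    (hfg : ∀ ψ : Space n → ℝ, IsTestFunction U ψ → ∀ s ∈ Icc 0 h,
      ∫ x, f x * fderiv ℝ ψ (x - s • e) e = -∫ x, g x * ψ (x - s • e)) :
    ∀ᵐ x ∂volume, x ∈ U →
      (translate e h f - f - ∫ s in (0 : ℝ)..h, translate e s g : L2Space n) x = 0 := by
  refine hU.ae_eq_zero_of_integral_contDiff_smul_eq_zero
    (((Lp.memLp _).locallyIntegrable (by norm_num)).locallyIntegrableOn U) ?_
  intro ψ h1 h2 h3
  have hψ : MemLp ψ 2 (volume : Measure (Space n)) := h1.continuous.memLp_of_hasCompactSupport h2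
  have hcont : Continuous fun s => inner ℝ (translate e s g) (hψ.toLp ψ) :=
    (continuous_translate e g).inner continuous_const
  have h4 : inner ℝ (∫ s in (0 : ℝ)..h, translate e s g) (hψ.toLp ψ)
      = inner ℝ (translate e h f) (hψ.toLp ψ) - inner ℝ f (hψ.toLp ψ) := by
    have h5 := (innerSL ℝ (hψ.toLp ψ)).intervalIntegral_comp_comm
      ((continuous_translate e g).intervalIntegrable (μ := volume) 0 h)
    simp only [innerSL_apply_apply] at h5
    rw [real_inner_comm, ← h5]
    simp only [real_inner_comm (translate e _ g)] at h5 ⊢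
    have h6 := intervalIntegral.integral_eq_sub_of_hasDerivAt (a := 0) (b := h)
      (f := fun s : ℝ => ∫ x, f x * ψ (x - s • e))
      (f' := fun s => inner ℝ (translate e s g) (hψ.toLp ψ)) (fun s hs => by
        rw [uIcc_of_le hh] at hs
        rw [inner_translate, ← neg_neg (∫ x, g x * ψ (x - s • e)), ← hfg ψ ⟨h1, h2, h3⟩ s hs]
        exact hasDerivAt_integral_mul_translate e f h1 h2 s) (hcont.intervalIntegrable 0 h)
    simp only [← inner_translate e _ f hψ, translate_zero] at h6
    exact h6
  have h7 : inner ℝ (translate e h f - f - ∫ s in (0 : ℝ)..h, translate e s g) (hψ.toLp ψ) = 0 := by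
    rw [inner_sub_left, inner_sub_left, h4, sub_self]
  rw [MeasureTheory.L2.inner_def] at h7
  refine Eq.trans ?_ h7
  refine integral_congr_ae ?_
  filter_upwards [hψ.coeFn_toLp] with x hx
  rw [hx]
  simp

/-- If the increments of `f` in the direction `e` are the integrals of `g`, then `g` has integral
zero over each set of finite measure on which `f` vanishes. For small `h`, most points `x` of such a
set `Y` have `x + h e ∈ Y` too, and at those the increment of `f` is zero. -/
lemma setIntegral_eq_zero_of_translate (e : Space n) {U Y : Set (Space n)} (f g : L2Space n)
    {δ : ℝ} (hδ : 0 < δ)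
    (hfg : ∀ h ∈ Icc 0 δ, ∀ᵐ x ∂volume, x ∈ U →
      (translate e h f - f - ∫ s in (0 : ℝ)..h, translate e s g : L2Space n) x = 0)
    (hY : MeasurableSet Y) (hYfin : volume Y ≠ ⊤) (hYU : Y ⊆ U) (hYf : ∀ x ∈ Y, f x = 0) :
    ∫ x in Y, g x = 0 := by
  set one : L2Space n := indicatorConstLp 2 hY hYfin 1 with hone
  set J : ℝ → L2Space n := fun h => ∫ s in (0 : ℝ)..h, translate e s g with hJ
  set p : ℝ → L2Space n := fun h => one ⊓ translate e h one with hp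
  have hplim : Filter.Tendsto p (nhdsWithin 0 (Ioi 0)) (nhds one) := by
    have hpc : Continuous p := continuous_const.inf (continuous_translate e one)
    have := hpc.tendsto 0
    rw [hp] at this
    simp only [translate_zero, inf_idem] at this
    exact this.mono_left nhdsWithin_le_nhds
  have hJlim : Filter.Tendsto (fun h => h⁻¹ • J h) (nhdsWithin 0 (Ioi 0)) (nhds g) := by
    have hc := continuous_translate e g
    have hd : HasDerivAt J (translate e 0 g) 0 := intervalIntegral.integral_hasDerivAt_right
      (hc.intervalIntegrable 0 0) (hc.stronglyMeasurableAtFilter _ _) hc.continuousAt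
    rw [translate_zero] at hd
    have := (hasDerivAt_iff_tendsto_slope.1 hd).mono_left
      (nhdsWithin_mono 0 fun x (hx : 0 < x) => hx.ne')
    refine this.congr fun h => ?_
    simp [slope, hJ]
  have hzero : ∀ h ∈ Ioo 0 δ, inner ℝ (h⁻¹ • J h) (p h) = 0 := by
    intro h hh
    rw [inner_smul_left, MeasureTheory.L2.inner_def]
    refine mul_eq_zero_of_right _ (integral_eq_zero_of_ae ?_)
    -- `x ↦ x + h e` maps null sets to null sets, so `1_Y` may be evaluated at `x + h e`
    have hshift : ∀ᵐ x ∂volume, one (h • e + x) = Y.indicator (fun _ => (1 : ℝ)) (h • e + x) :=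
      (measurePreserving_add_left volume (h • e)).quasiMeasurePreserving.ae
        indicatorConstLp_coeFn
    filter_upwards [hfg h (Ioo_subset_Icc_self hh), Lp.coeFn_inf one (translate e h one),
      coeFn_translate e h one, hshift, coeFn_translate e h f,
      Lp.coeFn_sub (translate e h f - f) (J h), Lp.coeFn_sub (translate e h f) f,
      (indicatorConstLp_coeFn : one =ᵐ[volume] Y.indicator fun _ => (1 : ℝ))]
      with x h1 h2 h3 h4 h5 h6 h7 h8
    have hpx : p h x
        = Y.indicator (fun _ => (1 : ℝ)) x ⊓ Y.indicator (fun _ => (1 : ℝ)) (h • e + x) := by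
      rw [hp, h2, Pi.inf_apply, h3, h4, h8]
    by_cases hx : x ∈ Y
    · by_cases hx' : h • e + x ∈ Y
      · have h9 := h1 (hYU hx)
        rw [h6, Pi.sub_apply, h7, Pi.sub_apply, h5, hYf _ hx', hYf _ hx] at h9
        have h10 : J h x = 0 := by linarith
        simp [h10]
      · simp [hpx, hx, hx']
    · have : p h x = 0 := by
        rw [hpx, indicator_of_notMem hx]
        exact inf_eq_left.2 (indicator_nonneg (fun _ _ => zero_le_one) _)
      simp [this]
  have hlim : Filter.Tendsto (fun h => inner ℝ (h⁻¹ • J h) (p h)) (nhdsWithin 0 (Ioi 0))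
      (nhds (inner ℝ g one)) := hJlim.inner hplim
  have h0 : inner ℝ g one = 0 := by
    refine tendsto_nhds_unique hlim (tendsto_const_nhds.congr' ?_)
    filter_upwards [Ioo_mem_nhdsGT hδ] with h hh
    exact (hzero h hh).symm
  rwa [real_inner_comm, hone, L2.inner_indicatorConstLp_one] at h0

lemma IsTestFunction.comp_sub {U : Set (Space n)} {ψ : Space n → ℝ} (hψ : IsTestFunction U ψ)
    (c : Space n) (hc : ∀ y ∈ U, y + c ∈ Ω) : IsTestFunction Ω fun x => ψ (x - c) where
  smooth := hψ.smooth.comp (contDiff_id.sub contDiff_const)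
  compact := hψ.compact.comp_homeomorph (Homeomorph.subRight c)
  support_subset := by
    refine (tsupport_comp_subset_preimage ψ (f := fun x => x - c) (by fun_prop)).trans
      fun x hx => ?_
    simpa using hc _ (hψ.support_subset hx)

/-- **Stampacchia's theorem**: a weak partial derivative of `v` vanishes almost everywhere on the
zero set of `v`. -/
theorem HasWeakPartial.ae_eq_zero (hΩ : IsOpen Ω) {i : Fin n} {v g : L2 Ω}
    (hv : HasWeakPartial Ω i v g) : ∀ᵐ x ∂volume.restrict Ω, v x = 0 → g x = 0 := by
  set e : Space n := EuclideanSpace.single i (1 : ℝ) with he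
  have hext : ∀ w : L2 Ω, MemLp (Ω.indicator w) 2 volume := fun w =>
    (memLp_indicator_iff_restrict hΩ.measurableSet).2 (Lp.memLp w)
  have hint : ∀ (w : L2 Ω) (φ : Space n → ℝ),
      ∫ x, (hext w).toLp _ x * φ x = ∫ x in Ω, w x * φ x := by
    intro w φ
    rw [← integral_indicator hΩ.measurableSet]
    refine integral_congr_ae ?_
    filter_upwards [(hext w).coeFn_toLp] with x hx
    rw [hx, indicator_mul_left]
  set F : L2Space n := (hext v).toLp _ with hF
  set G : L2Space n := (hext g).toLp _ with hG
  have key : ∀ᵐ x ∂volume, x ∈ Ω → F x = 0 → G x = 0 := by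
    refine measure_null_of_locally_null _ fun x₀ hx₀ => ?_
    simp only [mem_compl_iff, mem_ofPred_eq, Classical.not_imp] at hx₀
    obtain ⟨ε, hε, hball⟩ := Metric.isOpen_iff.1 hΩ x₀ hx₀.1
    set U := Metric.ball x₀ (ε / 2) with hU
    have hloc : ∀ h ∈ Icc 0 (ε / 2), ∀ᵐ x ∂volume, x ∈ U →
        (translate e h F - F - ∫ s in (0 : ℝ)..h, translate e s G : L2Space n) x = 0 := by
      intro h hh
      refine translate_sub_ae_eq e Metric.isOpen_ball F G hh.1 fun ψ hψ s hs => ?_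
      have hψs : IsTestFunction Ω fun x => ψ (x - s • e) := hψ.comp_sub _ fun y hy => hball <| by
        rw [Metric.mem_ball, dist_eq_norm] at hy
        rw [Metric.mem_ball, dist_eq_norm]
        calc ‖y + s • e - x₀‖ = ‖(y - x₀) + s • e‖ := by congr 1; abel
          _ ≤ ‖y - x₀‖ + ‖s • e‖ := norm_add_le _ _
          _ = ‖y - x₀‖ + s := by simp [norm_smul, he, abs_of_nonneg hs.1]
          _ < ε := by linarith [hs.2, hh.2]
      rw [hF, hG, hint, hint, ← hv _ hψs]
      congr 1
      ext x
      rw [partialDeriv, fderiv_comp_sub]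
    have hFm : MeasurableSet {x | F x = 0} :=
      (Lp.stronglyMeasurable F).measurable (measurableSet_singleton 0)
    set Z : Set (Space n) := U ∩ {x | F x = 0} with hZ
    have hZm : MeasurableSet Z := measurableSet_ball.inter hFm
    have hZfin : volume Z ≠ ⊤ := ((measure_mono inter_subset_left).trans_lt
      (measure_ball_lt_top (x := x₀))).ne
    have hGZ : Integrable G (volume.restrict Z) := by
      have : IsFiniteMeasure (volume.restrict Z) := ⟨by simpa using hZfin.lt_top⟩
      exact ((Lp.memLp G).restrict Z).integrable (by norm_num)
    have h0 : G =ᵐ[volume.restrict Z] 0 :=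
      hGZ.ae_eq_zero_of_forall_setIntegral_eq_zero fun s hs _ => by
        rw [Measure.restrict_restrict hs]
        exact setIntegral_eq_zero_of_translate e F G (half_pos hε) hloc (hs.inter hZm)
          ((measure_mono inter_subset_right).trans_lt hZfin.lt_top).ne
          (fun x hx => hx.2.1) fun x hx => hx.2.2
    have h1 : ∀ᵐ x ∂volume, x ∈ Z → G x = 0 := (ae_restrict_iff' hZm).1 h0
    refine ⟨{x | ¬(x ∈ Z → G x = 0)}, ?_, h1⟩
    filter_upwards [mem_nhdsWithin_of_mem_nhds (Metric.ball_mem_nhds x₀ (half_pos hε)),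
      self_mem_nhdsWithin] with x hx hx'
    simp only [mem_compl_iff, mem_ofPred_eq, Classical.not_imp] at hx' ⊢
    exact ⟨⟨hx, hx'.2.1⟩, hx'.2.2⟩
  rw [ae_restrict_iff' hΩ.measurableSet]
  filter_upwards [key, (hext v).coeFn_toLp, (hext g).coeFn_toLp] with x h1 h2 h3 hx h4
  rw [indicator_of_mem hx] at h2 h3
  rw [← h3]
  exact h1 hx (h2.trans h4)

/-! ### Curves in a Hilbert space with square integrable derivative -/

/-- A function whose increments over short intervals are quadratically small, up to negative
contributions, is nonincreasing: sum over a partition into `N` equal pieces and let `N → ∞`. -/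
lemma le_of_forall_sub_le_mul_sub {φ V : ℝ → ℝ} {a b : ℝ} (hab : a ≤ b)
    (h : ∀ s t, a ≤ s → s ≤ t → t ≤ b → φ t - φ s ≤ (t - s) * (V t - V s)) : φ b ≤ φ a := by
  have hN : ∀ N : ℕ, 0 < N → φ b - φ a ≤ (b - a) * (V b - V a) * (N : ℝ)⁻¹ := by
    intro N hN
    have hN' : (0 : ℝ) < N := Nat.cast_pos.2 hN
    set d : ℝ := (b - a) / N with hd
    have hd0 : 0 ≤ d := div_nonneg (sub_nonneg.2 hab) hN'.le
    have hNd : N * d = b - a := by rw [hd]; field_simp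
    have hind : ∀ k : ℕ, k ≤ N → φ (a + k * d) - φ a ≤ d * (V (a + k * d) - V a) := by
      intro k
      induction k with
      | zero => intro _; simp
      | succ k ih =>
        intro hk
        have hk' : ((k + 1 : ℕ) : ℝ) ≤ N := Nat.cast_le.2 hk
        have h1 := h (a + k * d) (a + (k + 1 : ℕ) * d)
          (by nlinarith [mul_nonneg (Nat.cast_nonneg (α := ℝ) k) hd0])
          (by push_cast; nlinarith) (by nlinarith [mul_le_mul_of_nonneg_right hk' hd0])
        have h2 := ih (by omega)
        have h3 : a + (k + 1 : ℕ) * d - (a + k * d) = d := by push_cast; ring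
        rw [h3] at h1
        linarith
    have := hind N le_rfl
    rw [hNd, add_sub_cancel] at this
    refine this.trans_eq ?_
    rw [hd]; ring
  have hlim : Filter.Tendsto (fun N : ℕ => (b - a) * (V b - V a) * (N : ℝ)⁻¹) Filter.atTop
      (nhds 0) := by
    simpa using tendsto_inv_atTop_nhds_zero_nat.const_mul ((b - a) * (V b - V a))
  have := ge_of_tendsto hlim (Filter.eventually_atTop.2 ⟨1, fun N hN' => hN N hN'⟩)
  linarith

section Evolution

variable {E : Type*} [NormedAddCommGroup E]

lemma intervalIntegrable_of_mem {T : ℝ} {v : ℝ → E}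
    (hv : IntegrableOn v (Ioo 0 T)) {s t : ℝ} (hs : 0 ≤ s) (hst : s ≤ t) (ht : t ≤ T) :
    IntervalIntegrable v volume s t := by
  rw [intervalIntegrable_iff_integrableOn_Ioo_of_le hst]
  exact hv.mono_set (Ioo_subset_Ioo hs ht)

lemma integrableOn_norm_sq {T : ℝ} {v : ℝ → E} (hv : MemLp v 2 (volume.restrict (Ioo 0 T))) :
    IntegrableOn (fun t => ‖v t‖ ^ 2) (Ioo 0 T) :=
  (memLp_two_iff_integrable_sq_norm hv.1).1 hv

/-- The Cauchy–Schwarz inequality on a time interval. -/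
lemma sq_integral_norm_le {T : ℝ} {v : ℝ → E} (hv : MemLp v 2 (volume.restrict (Ioo 0 T)))
    {s t : ℝ} (hs : 0 ≤ s) (hst : s ≤ t) (ht : t ≤ T) :
    (∫ r in s..t, ‖v r‖) ^ 2 ≤ (t - s) * ∫ r in s..t, ‖v r‖ ^ 2 := by
  rcases hst.eq_or_lt with rfl | hlt
  · simp
  have h1 : IntervalIntegrable (fun r => ‖v r‖) volume s t :=
    intervalIntegrable_of_mem (hv.integrable (by norm_num)).norm hs hst ht
  have h2 : IntervalIntegrable (fun r => ‖v r‖ ^ 2) volume s t :=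
    intervalIntegrable_of_mem (integrableOn_norm_sq hv) hs hst ht
  set B := ∫ r in s..t, ‖v r‖ with hB
  -- expand `∫ (‖v‖ - c)² ≥ 0` with `c` the mean value of `‖v‖`
  set c := B / (t - s) with hc
  have hpos : 0 < t - s := sub_pos.2 hlt
  have h3 : 0 ≤ ∫ r in s..t, (‖v r‖ - c) ^ 2 :=
    intervalIntegral.integral_nonneg hst fun r _ => sq_nonneg _
  have h4 : ∫ r in s..t, (‖v r‖ - c) ^ 2
      = (∫ r in s..t, ‖v r‖ ^ 2) - 2 * c * B + c ^ 2 * (t - s) := by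
    have : ∀ r, (‖v r‖ - c) ^ 2 = ‖v r‖ ^ 2 - 2 * c * ‖v r‖ + c ^ 2 := fun r => by ring
    simp only [this]
    rw [intervalIntegral.integral_add (h2.sub (h1.const_mul _)) intervalIntegrable_const,
      intervalIntegral.integral_sub h2 (h1.const_mul _), intervalIntegral.integral_const_mul,
      intervalIntegral.integral_const, smul_eq_mul, mul_comm (t - s)]
  have h5 : c * (t - s) = B := by rw [hc]; field_simp
  rw [h4] at h3
  nlinarith

variable [InnerProductSpace ℝ E]

lemma sub_eq_integral_of_forall {T : ℝ} {z v : ℝ → E} (hv : MemLp v 2 (volume.restrict (Ioo 0 T)))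
    (hz : ∀ t ∈ Icc 0 T, z t = z 0 + ∫ s in (0 : ℝ)..t, v s) {s t : ℝ} (hs : 0 ≤ s) (hst : s ≤ t)
    (ht : t ≤ T) : z t - z s = ∫ r in s..t, v r := by
  have hv' : IntegrableOn v (Ioo 0 T) := hv.integrable (by norm_num)
  rw [hz t ⟨hs.trans hst, ht⟩, hz s ⟨hs, hst.trans ht⟩, add_sub_add_left_eq_sub,
    intervalIntegral.integral_interval_sub_left
      (intervalIntegrable_of_mem hv' le_rfl (hs.trans hst) ht)
      (intervalIntegrable_of_mem hv' le_rfl hs (hst.trans ht))]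

lemma norm_sub_sq_le {T : ℝ} {z v : ℝ → E} (hv : MemLp v 2 (volume.restrict (Ioo 0 T)))
    (hz : ∀ t ∈ Icc 0 T, z t = z 0 + ∫ s in (0 : ℝ)..t, v s) {s t : ℝ} (hs : 0 ≤ s) (hst : s ≤ t)
    (ht : t ≤ T) : ‖z t - z s‖ ^ 2 ≤ (t - s) * ∫ r in s..t, ‖v r‖ ^ 2 := by
  refine le_trans ?_ (sq_integral_norm_le hv hs hst ht)
  rw [sub_eq_integral_of_forall hv hz hs hst ht]
  exact pow_le_pow_left₀ (norm_nonneg _) (intervalIntegral.norm_integral_le_integral_norm hst) 2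

variable [CompleteSpace E]

/-- Energy dissipation without a chain rule: if `P` is a `1`-Lipschitz subgradient of the convex
function `Φ` and `⟪P (z s), z' s⟫ ≤ 0` for almost every time `s`, then `Φ ∘ z` does not exceed its
initial value. -/
lemma le_of_inner_nonpos {T : ℝ} {z v : ℝ → E} (hv : MemLp v 2 (volume.restrict (Ioo 0 T)))
    (hz : ∀ t ∈ Icc 0 T, z t = z 0 + ∫ s in (0 : ℝ)..t, v s) {P : E → E} {Φ : E → ℝ}
    (hP : ∀ x y, ‖P x - P y‖ ≤ ‖x - y‖) (hΦ : ∀ x y, Φ x - Φ y ≤ inner ℝ (P x) (x - y))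
    (hdiss : ∀ᵐ s ∂volume.restrict (Ioo 0 T), inner ℝ (P (z s)) (v s) ≤ 0)
    {t : ℝ} (ht : t ∈ Icc 0 T) : Φ (z t) ≤ Φ (z 0) := by
  have hv' : IntegrableOn v (Ioo 0 T) := hv.integrable (by norm_num)
  refine le_of_forall_sub_le_mul_sub (φ := fun t => Φ (z t))
    (V := fun t => ∫ r in (0 : ℝ)..t, ‖v r‖ ^ 2) ht.1 fun s t' hs hst htt => ?_
  have htT : t' ≤ T := htt.trans ht.2
  have hi : IntervalIntegrable v volume s t' := intervalIntegrable_of_mem hv' hs hst htT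
  have hsq := integrableOn_norm_sq hv
  rw [intervalIntegral.integral_interval_sub_left
    (intervalIntegrable_of_mem hsq le_rfl (hs.trans hst) htT)
    (intervalIntegrable_of_mem hsq le_rfl hs (hst.trans htT))]
  refine le_trans ?_ (sq_integral_norm_le hv hs hst htT)
  set B := ∫ r in s..t', ‖v r‖ with hB
  have h1 : inner ℝ (P (z t')) (z t' - z s) = ∫ r in s..t', inner ℝ (P (z t')) (v r) := by
    rw [sub_eq_integral_of_forall hv hz hs hst htT]
    exact ((innerSL ℝ (P (z t'))).intervalIntegral_comp_comm hi).symm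
  calc Φ (z t') - Φ (z s) ≤ ∫ r in s..t', inner ℝ (P (z t')) (v r) := (hΦ _ _).trans_eq h1
    _ ≤ ∫ r in s..t', B * ‖v r‖ := by
      refine intervalIntegral.integral_mono_ae_restrict hst
        ⟨(hi.1.const_inner _), (hi.2.const_inner _)⟩ (hi.norm.const_mul B) ?_
      rw [← restrict_Ioo_eq_restrict_Icc]
      have h2 := ae_mono (Measure.restrict_mono (μ := volume) (Ioo_subset_Ioo hs htT) le_rfl) hdiss
      filter_upwards [h2, ae_restrict_mem measurableSet_Ioo] with r hr hrm
      have h3 : ‖z t' - z r‖ ≤ B := by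
        rw [sub_eq_integral_of_forall hv hz (hs.trans hrm.1.le) hrm.2.le htT]
        refine (intervalIntegral.norm_integral_le_integral_norm hrm.2.le).trans ?_
        exact intervalIntegral.integral_mono_interval hrm.1.le hrm.2.le le_rfl
          (.of_forall fun _ => norm_nonneg _) hi.norm
      calc inner ℝ (P (z t')) (v r)
          = inner ℝ (P (z t') - P (z r)) (v r) + inner ℝ (P (z r)) (v r) := by
            rw [inner_sub_left]; ring
        _ ≤ ‖P (z t') - P (z r)‖ * ‖v r‖ + 0 := add_le_add (real_inner_le_norm _ _) hr
        _ ≤ B * ‖v r‖ := by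
          rw [add_zero]
          exact mul_le_mul_of_nonneg_right ((hP _ _).trans h3) (norm_nonneg _)
    _ = B ^ 2 := by rw [intervalIntegral.integral_const_mul, sq]

end Evolution

/-! ### Times of bounded energy -/

/-- Let `Ψ` grow over time steps of length `h` by at most `h D`, with `D` integrable. Then `Ψ` is
bounded above along times tending to any `t > 0` from the left: arbitrarily close to `t` there are
times `s`, which may be taken in any set of full measure, at which `Ψ s ≤ M`. The inequality,
integrated over `(a + h, t)`, compares the mean of `Ψ` over `(t - h, t)` with the mean over
`(a, a + h)`, and the latter stays bounded as `h → 0` if `a` is a Lebesgue point. -/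
lemma exists_bound_near {T : ℝ} {Ψ D : ℝ → ℝ} (hΨ : IntegrableOn Ψ (Ioo 0 T))
    (hD : IntegrableOn D (Ioo 0 T)) (hD0 : ∀ t, 0 ≤ D t)
    (hstep : ∀ h, 0 < h → ∀ᵐ r ∂volume.restrict (Ioo h T), Ψ r - Ψ (r - h) ≤ h * D r)
    {t : ℝ} (ht0 : 0 < t) (htT : t ≤ T) :
    ∃ M, ∀ p : ℝ → Prop, (∀ᵐ s ∂volume.restrict (Ioo 0 T), p s) → ∀ ε > 0,
      ∃ s ∈ Ioo (t - ε) t, p s ∧ Ψ s ≤ M := by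
  have hΨi : ∀ {a b}, 0 ≤ a → a ≤ b → b ≤ T → IntervalIntegrable Ψ volume a b :=
    fun h1 h2 h3 => intervalIntegrable_of_mem hΨ h1 h2 h3
  have hDi : ∀ {a b}, 0 ≤ a → a ≤ b → b ≤ T → IntervalIntegrable D volume a b :=
    fun h1 h2 h3 => intervalIntegrable_of_mem hD h1 h2 h3
  obtain ⟨a, ha, hderiv⟩ : ∃ a ∈ Ioo 0 t,
      HasDerivAt (fun x => ∫ s in (0 : ℝ)..x, Ψ s) (Ψ a) a := by
    have hae := (hΨi le_rfl ht0.le htT).ae_hasDerivAt_integral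
    have hne : (volume.restrict (Ioo 0 t)) ≠ 0 := by
      simp [Measure.restrict_eq_zero, ht0]
    have : (ae (volume.restrict (Ioo 0 t))).NeBot := ae_neBot.2 hne
    obtain ⟨a, ha, ham⟩ := ((ae_restrict_of_ae hae).and
      (ae_restrict_mem (measurableSet_Ioo (a := (0 : ℝ)) (b := t)))).exists
    have ha' : a ∈ uIcc 0 t := by rw [uIcc_of_le ht0.le]; exact Ioo_subset_Icc_self ham
    exact ⟨a, ham, ha ha' 0 left_mem_uIcc⟩
  set C := ∫ s in (0 : ℝ)..T, D s with hC
  refine ⟨Ψ a + 1 + C + 1, fun p hp ε hε => ?_⟩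
  have hev : ∀ᶠ h in nhdsWithin (0 : ℝ) (Ioi 0), ∫ s in a..a + h, Ψ s ≤ h * (Ψ a + 1) := by
    have h1 := hderiv.tendsto_slope_zero_right.eventually (gt_mem_nhds (lt_add_one (Ψ a)))
    filter_upwards [h1, Ioo_mem_nhdsGT (sub_pos.2 ha.2)] with h hh hh'
    have h2 : (∫ s in (0 : ℝ)..a + h, Ψ s) - ∫ s in (0 : ℝ)..a, Ψ s = ∫ s in a..a + h, Ψ s :=
      intervalIntegral.integral_interval_sub_left
        (hΨi le_rfl (by linarith [ha.1, hh'.1]) (by linarith [hh'.2]))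
        (hΨi le_rfl ha.1.le (by linarith [ha.2]))
    rw [h2, smul_eq_mul, inv_mul_lt_iff₀ hh'.1] at hh
    exact hh.le
  obtain ⟨h, hh, hh0, hhlt⟩ := (hev.and (Ioo_mem_nhdsGT
    (lt_min hε (sub_pos.2 ha.2)))).exists
  have hhε : h < ε := hhlt.trans_le (min_le_left _ _)
  have hht : a + h < t := by linarith [hhlt.trans_le (min_le_right ε (t - a))]
  have ha0 : 0 < a := ha.1
  have hshift : ∫ r in (a + h)..t, Ψ (r - h) = ∫ r in a..t - h, Ψ r := by
    rw [intervalIntegral.integral_comp_sub_right (fun r => Ψ r) h, add_sub_cancel_right]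
  have hshiftInt : IntervalIntegrable (fun r => Ψ (r - h)) volume (a + h) t := by
    have := (hΨi ha0.le (by linarith : a ≤ t - h) (by linarith)).comp_sub_right h
    simpa using this
  have hmono : (∫ r in (a + h)..t, Ψ r) - ∫ r in (a + h)..t, Ψ (r - h) ≤ h * C := by
    have hi := hΨi (by linarith : 0 ≤ a + h) hht.le htT
    rw [← intervalIntegral.integral_sub hi hshiftInt]
    calc ∫ r in (a + h)..t, (Ψ r - Ψ (r - h)) ≤ ∫ r in (a + h)..t, h * D r := by
          refine intervalIntegral.integral_mono_ae_restrict hht.le (hi.sub hshiftInt)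
            ((hDi (by linarith) hht.le htT).const_mul h) ?_
          rw [← restrict_Ioo_eq_restrict_Icc]
          exact ae_mono (Measure.restrict_mono (μ := volume)
            (Ioo_subset_Ioo (by linarith) htT) le_rfl) (hstep h hh0)
      _ = h * ∫ r in (a + h)..t, D r := intervalIntegral.integral_const_mul _ _
      _ ≤ h * C := by
          refine mul_le_mul_of_nonneg_left ?_ hh0.le
          exact intervalIntegral.integral_mono_interval (by linarith) hht.le htT
            (.of_forall hD0) (hDi le_rfl (ht0.le.trans htT) le_rfl)
  have hmean : ∫ r in (t - h)..t, Ψ r ≤ h * (Ψ a + 1 + C) := by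
    have i1 := hΨi ha0.le (by linarith : a ≤ a + h) (by linarith)
    have i2 := hΨi (by linarith : 0 ≤ a + h) hht.le htT
    have i3 := hΨi ha0.le (by linarith : a ≤ t - h) (by linarith)
    have i4 := hΨi (by linarith : 0 ≤ t - h) (by linarith) htT
    have e1 := intervalIntegral.integral_add_adjacent_intervals i1 i2
    have e2 := intervalIntegral.integral_add_adjacent_intervals i3 i4
    rw [hshift] at hmono
    linarith
  by_contra! hcon
  have hi := hΨi (by linarith : 0 ≤ t - h) (by linarith : t - h ≤ t) htT
  have hbig : ∫ _ in (t - h)..t, (Ψ a + 1 + C + 1) ≤ ∫ r in (t - h)..t, Ψ r := by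
    refine intervalIntegral.integral_mono_ae_restrict (by linarith) intervalIntegrable_const hi ?_
    rw [← restrict_Ioo_eq_restrict_Icc]
    have hp' := ae_mono (Measure.restrict_mono (μ := volume)
      (Ioo_subset_Ioo (by linarith : 0 ≤ t - h) htT) le_rfl) hp
    filter_upwards [hp', ae_restrict_mem measurableSet_Ioo] with s hs hsm
    exact (hcon s ⟨by linarith [hsm.1], hsm.2⟩ hs).le
  rw [intervalIntegral.integral_const, smul_eq_mul] at hbig
  nlinarith

/-! ### Solutions lie in `H¹₀(Ω)` at every time -/

/-- The Dirichlet energy is convex, with `-2Δ` as its gradient. -/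
lemma sum_norm_sq_weakPartial_sub_le {y z : L2 Ω} (hy : y ∈ H10 Ω) (hy2 : y ∈ H2 Ω)
    (hz : z ∈ H10 Ω) :
    ∑ i, ‖weakPartial i y‖ ^ 2 - ∑ i, ‖weakPartial i z‖ ^ 2
      ≤ -2 * inner ℝ (laplacian y) (y - z) := by
  rw [inner_sub_right, inner_laplacian hy2 hy, inner_laplacian hy2 hz]
  have : ∀ i, ‖weakPartial i y‖ ^ 2 - ‖weakPartial i z‖ ^ 2
      ≤ 2 * inner ℝ (weakPartial i y) (weakPartial i y)
        - 2 * inner ℝ (weakPartial i y) (weakPartial i z) := by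
    intro i
    have h := norm_sub_sq_real (weakPartial i y) (weakPartial i z)
    rw [real_inner_self_eq_norm_sq]
    nlinarith [sq_nonneg ‖weakPartial i y - weakPartial i z‖]
  have h := Finset.sum_le_sum fun i (_ : i ∈ Finset.univ) => this i
  rw [Finset.sum_sub_distrib, Finset.sum_sub_distrib, ← Finset.mul_sum, ← Finset.mul_sum] at h
  linarith

/-- A function in `L²(0,T; H¹₀ ∩ H²)` with time derivative in `L²(0,T; L²)` has values in `H¹₀` at
every time, not merely at almost every time: its Dirichlet energy stays bounded along a sequence of
good times tending to any given time. -/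
lemma mem_H10_of_hasTimeDeriv (hΩ : IsOpen Ω) {T : ℝ} {u ut : ℝ → L2 Ω} (hu : MemL2H10H2 Ω T u)
    (hut : HasTimeDeriv T u ut) (h0 : u 0 ∈ H10 Ω) {t : ℝ} (ht : t ∈ Icc 0 T) : u t ∈ H10 Ω := by
  rcases ht.1.eq_or_lt with rfl | htpos
  · exact h0
  set G : ℝ → ℝ := fun s => ∑ i, ‖weakPartial i (u s)‖ ^ 2 with hG
  set V : ℝ → ℝ := fun s => ∫ r in (0 : ℝ)..s, ‖ut r‖ ^ 2 with hV
  have hT : 0 ≤ T := ht.1.trans ht.2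
  have hsq := integrableOn_norm_sq hut.memLp
  have hVi : ∀ {s r}, 0 ≤ s → s ≤ r → r ≤ T →
      IntervalIntegrable (fun r => ‖ut r‖ ^ 2) volume s r :=
    fun h1 h2 h3 => intervalIntegrable_of_mem hsq h1 h2 h3
  have hGint : IntegrableOn G (Ioo 0 T) :=
    integrable_finsetSum _ fun i _ => integrableOn_norm_sq (hu.memLp_partial i)
  have hVint : IntegrableOn V (Ioo 0 T) := by
    have h1 : ContinuousOn V (uIcc 0 T) := intervalIntegral.continuousOn_primitive_interval
      ((intervalIntegrable_iff_integrableOn_Icc_of_le hT).1 (hVi le_rfl hT le_rfl) |>.mono_set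
        (by rw [uIcc_of_le hT]))
    rw [uIcc_of_le hT] at h1
    exact (h1.integrableOn_Icc).mono_set Ioo_subset_Icc_self
  have hDint : IntegrableOn (fun s => ‖laplacian (u s)‖ ^ 2) (Ioo 0 T) := by
    refine integrableOn_norm_sq ?_
    simp only [laplacian]
    exact memLp_finsetSum _ fun i _ => hu.memLp_partial_partial i i
  obtain ⟨M, hM⟩ := exists_bound_near (Ψ := fun s => G s - V s)
    (D := fun s => ‖laplacian (u s)‖ ^ 2) (hGint.sub hVint) hDint (fun s => sq_nonneg _) (by
      intro h hh
      have hgood := (ae_restrict_iff' measurableSet_Ioo).1 hu.mem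
      have hgood' := (measurePreserving_sub_right volume h).quasiMeasurePreserving.ae hgood
      filter_upwards [ae_restrict_of_ae hgood, ae_restrict_of_ae hgood',
        ae_restrict_mem measurableSet_Ioo] with r h1 h2 hr
      obtain ⟨h3, h4⟩ := h1 ⟨hh.trans hr.1, hr.2⟩
      obtain ⟨h5, -⟩ := h2 ⟨by linarith [hr.1], by linarith [hr.2]⟩
      have h6 := sum_norm_sq_weakPartial_sub_le h3 h4 h5
      have h7 := norm_sub_sq_le hut.memLp hut.eq_integral (s := r - h) (t := r)
        (by linarith [hr.1]) (by linarith) hr.2.le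
      have h8 : V r - V (r - h) = ∫ s in (r - h)..r, ‖ut s‖ ^ 2 :=
        intervalIntegral.integral_interval_sub_left (hVi le_rfl (by linarith [hr.1]) hr.2.le)
          (hVi le_rfl (by linarith [hr.1]) (by linarith [hr.2]))
      rw [← h8, sub_sub_cancel] at h7
      have h9 := neg_le_of_abs_le (abs_real_inner_le_norm (laplacian (u r)) (u r - u (r - h)))
      set A := ‖laplacian (u r)‖
      set B := ‖u r - u (r - h)‖
      -- `2AB ≤ hA² + B²/h`
      have h10 : 2 * (A * B) ≤ h * A ^ 2 + (V r - V (r - h)) := by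
        have h11 : 0 ≤ (h * A - B) ^ 2 := sq_nonneg _
        have h12 : h * (2 * (A * B)) ≤ h * (h * A ^ 2 + (V r - V (r - h))) := by nlinarith
        exact le_of_mul_le_mul_left h12 hh
      change G r - V r - (G (r - h) - V (r - h)) ≤ h * A ^ 2
      change G r - G (r - h) ≤ _ at h6
      linarith) htpos ht.2
  choose s hs hsgood hsM using fun k : ℕ => hM (fun s => s ∈ Ioo 0 T ∧ u s ∈ H10 Ω)
    (by filter_upwards [hu.mem, ae_restrict_mem measurableSet_Ioo] with s h1 h2 using ⟨h2, h1.1⟩)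
    (1 / ((k : ℝ) + 1)) (by positivity)
  have hslim : Filter.Tendsto s Filter.atTop (nhds t) := by
    refine tendsto_of_tendsto_of_tendsto_of_le_of_le ?_ tendsto_const_nhds
      (fun k => (hs k).1.le) fun k => (hs k).2.le
    simpa using tendsto_one_div_add_atTop_nhds_zero_nat.const_sub t
  have hulim : Filter.Tendsto (fun k => u (s k)) Filter.atTop (nhds (u t)) := by
    rw [tendsto_iff_norm_sub_tendsto_zero]
    have hb : ∀ k, ‖u (s k) - u t‖ ≤ √((t - s k) * V T) := fun k => by
      refine Real.le_sqrt_of_sq_le ?_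
      rw [norm_sub_rev]
      refine (norm_sub_sq_le hut.memLp hut.eq_integral (hsgood k).1.1.le (hs k).2.le ht.2).trans ?_
      refine mul_le_mul_of_nonneg_left ?_ (sub_nonneg.2 (hs k).2.le)
      exact intervalIntegral.integral_mono_interval (hsgood k).1.1.le (hs k).2.le ht.2
        (.of_forall fun _ => sq_nonneg _) (hVi le_rfl hT le_rfl)
    refine squeeze_zero (fun _ => norm_nonneg _) hb ?_
    have : Filter.Tendsto (fun k => √((t - s k) * V T)) Filter.atTop
        (nhds √((t - t) * V T)) := ((hslim.const_sub t).mul_const _).sqrt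
    simpa using this
  refine mem_H10_of_tendsto hΩ (M := M + V T) (fun k => (hsgood k).2) (fun k => ?_) hulim
  have h1 : V (s k) ≤ V T := intervalIntegral.integral_mono_interval le_rfl (hsgood k).1.1.le
    (hsgood k).1.2.le (.of_forall fun _ => sq_nonneg _) (hVi le_rfl hT le_rfl)
  have h2 : G (s k) - V (s k) ≤ M := hsM k
  change G (s k) ≤ _
  linarith

/-! ### The three formulations of the problem -/

lemma half_norm_sq_sub_le_inner {E : Type*} [NormedAddCommGroup E] [InnerProductSpace ℝ E]
    (a b : E) : ‖a‖ ^ 2 / 2 - ‖b‖ ^ 2 / 2 ≤ inner ℝ a (a - b) := by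
  have h := norm_sub_sq_real a b
  rw [inner_sub_right, real_inner_self_eq_norm_sq]
  nlinarith [sq_nonneg ‖a - b‖]

/-- `x ↦ x ⊓ 0` is the gradient of the convex function `x ↦ ‖x ⊓ 0‖² / 2`. -/
lemma half_norm_sq_inf_zero_sub_le (x y : L2 Ω) :
    ‖x ⊓ 0‖ ^ 2 / 2 - ‖y ⊓ 0‖ ^ 2 / 2 ≤ inner ℝ (x ⊓ 0) (x - y) := by
  refine (half_norm_sq_sub_le_inner _ _).trans ?_
  rw [← sub_nonneg, ← inner_sub_right, L2.inner_eq_integral_mul]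
  refine integral_nonneg_of_ae ?_
  filter_upwards [Lp.coeFn_inf x 0, Lp.coeFn_inf y 0, Lp.coeFn_sub (x - y) (x ⊓ 0 - y ⊓ 0),
    Lp.coeFn_sub x y, Lp.coeFn_sub (x ⊓ 0) (y ⊓ 0), Lp.coeFn_zero ℝ 2 (volume.restrict Ω)]
    with p h1 h2 h3 h4 h5 h6
  rw [h3, Pi.sub_apply, h4, Pi.sub_apply, h5, Pi.sub_apply, h1, h2, Pi.inf_apply, Pi.inf_apply, h6,
    Pi.zero_apply]
  rcases le_total (x p) 0 with hx | hx <;> rcases le_total (y p) 0 with hy | hy <;>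
    simp only [hx, hy, inf_of_le_left, inf_of_le_right] <;> nlinarith

/-- A solution of the degenerate problem stays above the obstacle: it does not move where it
touches or lies below it, so `(u - uc)⁻` stays equal to its initial value `0`. -/
lemma SolvesDegenerate.obstacle_le {T : ℝ} {f uc u0 : L2 Ω} {u : ℝ → L2 Ω}
    (hu : SolvesDegenerate T f uc u0 u) (h0 : ∀ᵐ x ∂volume.restrict Ω, uc x ≤ u0 x)
    {t : ℝ} (ht : t ∈ Icc 0 T) : ∀ᵐ x ∂volume.restrict Ω, uc x ≤ u t x := by
  obtain ⟨-, ut, hut, heq, hinit⟩ := hu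
  have key := le_of_inner_nonpos (z := fun s => u s - uc) hut.memLp
    (fun s hs => by rw [hut.eq_integral s hs]; abel) (P := fun x => x ⊓ 0)
    (Φ := fun x => ‖x ⊓ 0‖ ^ 2 / 2) (fun x y => norm_inf_sub_inf_le_norm x y 0)
    half_norm_sq_inf_zero_sub_le (by
      filter_upwards [heq] with s hs
      rw [L2.inner_eq_integral_mul]
      refine (integral_eq_zero_of_ae ?_).le
      filter_upwards [hs, Lp.coeFn_inf (u s - uc) 0, Lp.coeFn_sub (u s) uc,
        Lp.coeFn_zero ℝ 2 (volume.restrict Ω)] with x h1 h2 h3 h4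
      rw [h2, Pi.inf_apply, h3, h4, Pi.sub_apply, Pi.zero_apply]
      rcases le_or_gt (u s x - uc x) 0 with hx | hx
      · rw [heaviside, if_neg hx.not_gt, zero_mul, sub_zero] at h1
        rw [h1, mul_zero]
      · rw [inf_of_le_right hx.le, zero_mul]) ht
  have hz0 : (u 0 - uc) ⊓ 0 = 0 := by
    rw [inf_eq_right, ← Lp.coeFn_le, hinit]
    filter_upwards [h0, Lp.coeFn_sub u0 uc, Lp.coeFn_zero ℝ 2 (volume.restrict Ω)] with x h1 h2 h3
    rw [h2, h3, Pi.sub_apply, Pi.zero_apply]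
    exact sub_nonneg.2 h1
  have hzt : (u t - uc) ⊓ 0 = 0 := by
    simp only [hz0, norm_zero] at key
    have : ‖(u t - uc) ⊓ 0‖ ^ 2 ≤ 0 := by linarith
    exact norm_eq_zero.1 (pow_eq_zero_iff two_ne_zero |>.1 (this.antisymm (sq_nonneg _)))
  rw [inf_eq_right, ← Lp.coeFn_le] at hzt
  filter_upwards [hzt, Lp.coeFn_sub (u t) uc, Lp.coeFn_zero ℝ 2 (volume.restrict Ω)]
    with x h1 h2 h3
  rw [h2, h3, Pi.sub_apply, Pi.zero_apply] at h1
  exact sub_nonneg.1 h1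

/-- Two functions in `H²(Ω)` have the same Laplacian almost everywhere on the set on which they
coincide. -/
lemma laplacian_ae_eq_of_eq (hΩ : IsOpen Ω) {v w : L2 Ω} (hv : v ∈ H2 Ω) (hw : w ∈ H2 Ω) :
    ∀ᵐ x ∂volume.restrict Ω, v x = w x → laplacian v x = laplacian w x := by
  have h1 : ∀ i, ∀ᵐ x ∂volume.restrict Ω, v x = w x →
      weakPartial i (weakPartial i v) x = weakPartial i (weakPartial i w) x := by
    intro i
    have e1 := ((hasWeakPartial_weakPartial (i := i) hv.1).sub
      (hasWeakPartial_weakPartial hw.1)).ae_eq_zero hΩ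
    have e2 := ((hasWeakPartial_weakPartial (i := i) (hv.2 i)).sub
      (hasWeakPartial_weakPartial (hw.2 i))).ae_eq_zero hΩ
    filter_upwards [e1, e2, Lp.coeFn_sub v w, Lp.coeFn_sub (weakPartial i v) (weakPartial i w),
      Lp.coeFn_sub (weakPartial i (weakPartial i v)) (weakPartial i (weakPartial i w))]
      with x h1 h2 h3 h4 h5 hx
    rw [h3, Pi.sub_apply, sub_eq_zero] at h1
    rw [h5, Pi.sub_apply, sub_eq_zero] at h2
    exact h2 (h1 hx)
  have hsum : ∀ y : L2 Ω, laplacian y =ᵐ[volume.restrict Ω]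
      fun x => ∑ i, weakPartial i (weakPartial i y) x := fun y => by
    rw [laplacian]
    refine (Lp.coeFn_finsetSum _ _).trans (.of_forall fun x => ?_)
    simp
  filter_upwards [ae_all_iff.2 h1, hsum v, hsum w] with x h2 h3 h4 hx
  rw [h3, h4]
  exact Finset.sum_congr rfl fun i _ => h2 i hx

/-- Where a solution of the degenerate problem touches the obstacle, `u_t = 0` and
`Δu + f = Δuc + f ≤ 0`; elsewhere `u_t = Δu + f`. -/
lemma SolvesDegenerate.solvesComplementarity (hΩ : IsOpen Ω) {T : ℝ} {f uc u0 : L2 Ω}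
    {u : ℝ → L2 Ω} (hu : SolvesDegenerate T f uc u0 u) (huc : uc ∈ H2 Ω)
    (h0 : ∀ᵐ x ∂volume.restrict Ω, uc x ≤ u0 x)
    (hf : ∀ᵐ x ∂volume.restrict Ω, laplacian uc x + f x ≤ 0) :
    SolvesComplementarity T f uc u0 u := by
  have hle := fun {t} (ht : t ∈ Icc 0 T) => hu.obstacle_le h0 ht
  obtain ⟨hmem, ut, hut, heq, hinit⟩ := hu
  refine ⟨hmem, ut, hut, ?_, hinit⟩
  filter_upwards [heq, hmem.mem, ae_restrict_mem measurableSet_Ioo] with t h1 h2 ht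
  filter_upwards [h1, hle (Ioo_subset_Icc_self ht), hf, laplacian_ae_eq_of_eq hΩ h2.2 huc]
    with x h3 h4 h5 h6
  rcases h4.eq_or_lt with h7 | h7
  · rw [heaviside, if_neg (by simp [h7]), zero_mul, sub_zero] at h3
    rw [h6 h7.symm, h3]
    exact ⟨h4, h5, by rw [h7]; ring⟩
  · rw [heaviside, if_pos (sub_pos.2 h7), one_mul] at h3
    refine ⟨h4, by linarith, ?_⟩
    rw [show ut t x - laplacian (u t) x - f x = 0 by linarith, mul_zero]

lemma SolvesComplementarity.solvesObstacle {T : ℝ} {f uc u0 : L2 Ω}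
    {w : ℝ → L2 Ω} (hw : SolvesComplementarity T f uc u0 w) (hu0 : u0 ∈ obstacleSet uc) :
    SolvesObstacle T f uc u0 w := by
  obtain ⟨hmem, wt, hwt, heq, hinit⟩ := hw
  refine ⟨hmem, wt, hwt, ?_, hinit, hu0⟩
  filter_upwards [heq, hmem.mem] with t h1 h2
  refine ⟨⟨h2.1, h1.mono fun x hx => hx.1⟩, fun φ hφ => integral_nonneg_of_ae ?_⟩
  filter_upwards [h1, hφ.2] with x hx hφx
  -- `(w_t - Δw - f) (φ - w) = (w_t - Δw - f) (φ - uc)` by complementarity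
  have : 0 ≤ (wt t x - laplacian (w t) x - f x) * (φ x - uc x) :=
    mul_nonneg (by linarith) (by linarith)
  change 0 ≤ (wt t x - laplacian (w t) x - f x) * (φ x - w t x)
  linarith [hx.2.2]

/-- Uniqueness for the parabolic obstacle problem, by testing each variational inequality with the
other solution. -/
lemma SolvesObstacle.unique {T : ℝ} {f uc u0 : L2 Ω} {u w : ℝ → L2 Ω}
    (hu : SolvesObstacle T f uc u0 u) (hw : SolvesObstacle T f uc u0 w) {t : ℝ}
    (ht : t ∈ Icc 0 T) : u t = w t := by
  obtain ⟨hum, ut, hut, hueq, hu0, -⟩ := hu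
  obtain ⟨hwm, wt, hwt, hweq, hw0, -⟩ := hw
  have hinner : ∀ a b c φ ψ : L2 Ω, ∫ x in Ω, (a x - b x - c x) * (φ x - ψ x)
      = inner ℝ (a - b - c) (φ - ψ) := by
    intro a b c φ ψ
    rw [L2.inner_eq_integral_mul]
    refine integral_congr_ae ?_
    filter_upwards [Lp.coeFn_sub (a - b) c, Lp.coeFn_sub a b, Lp.coeFn_sub φ ψ] with x h1 h2 h3
    rw [h1, h3, Pi.sub_apply, h2, Pi.sub_apply, Pi.sub_apply]
  have hInt : ∀ {v : ℝ → L2 Ω}, MemLp v 2 (volume.restrict (Ioo 0 T)) → ∀ s ∈ Icc 0 T,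
      IntervalIntegrable v volume 0 s := fun hv s hs =>
    intervalIntegrable_of_mem (hv.integrable (by norm_num)) le_rfl hs.1 hs.2
  have key := le_of_inner_nonpos (z := fun s => u s - w s) (v := fun s => ut s - wt s)
    (hut.memLp.sub hwt.memLp) (fun s hs => by
      rw [intervalIntegral.integral_sub (hInt hut.memLp s hs) (hInt hwt.memLp s hs),
        hut.eq_integral s hs, hwt.eq_integral s hs]
      abel) (P := fun x => x) (Φ := fun x => ‖x‖ ^ 2 / 2) (fun _ _ => le_rfl)
    half_norm_sq_sub_le_inner (by
      filter_upwards [hueq, hweq, hum.mem, hwm.mem] with s h1 h2 h3 h4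
      have h5 := h1.2 _ h2.1
      have h6 := h2.2 _ h1.1
      rw [hinner] at h5 h6
      have hgrad : inner ℝ (laplacian (u s) - laplacian (w s)) (u s - w s) ≤ 0 := by
        rw [inner_sub_left, inner_sub_right, inner_sub_right, inner_laplacian h3.2 h3.1,
          inner_laplacian h3.2 h4.1, inner_laplacian h4.2 h3.1, inner_laplacian h4.2 h4.1]
        have h7 : 0 ≤ ∑ i, ‖weakPartial i (u s) - weakPartial i (w s)‖ ^ 2 :=
          Finset.sum_nonneg fun i _ => sq_nonneg _
        simp only [← real_inner_self_eq_norm_sq, inner_sub_left, inner_sub_right,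
          Finset.sum_sub_distrib] at h7
        linarith
      rw [← neg_sub (u s) (w s), inner_neg_right] at h5
      simp only [inner_sub_left (𝕜 := ℝ) (E := L2 Ω) _ _ (u s - w s)] at h5 h6 hgrad
      rw [real_inner_comm, inner_sub_left]
      linarith) ht
  have : ‖u t - w t‖ ^ 2 ≤ 0 := by
    simp only [hu0, hw0, sub_self, norm_zero] at key
    linarith
  exact sub_eq_zero.1 (norm_eq_zero.1
    (pow_eq_zero_iff two_ne_zero |>.1 (this.antisymm (sq_nonneg _))))

end DegenerateDiffusion

open DegenerateDiffusion
theorem proposition1 {n : ℕ} {Ω : Set (Space n)} (hΩ : IsSmoothBoundedDomain Ω)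
    {T : ℝ} (hT : 0 < T) (f uc u0 : L2 Ω)
    (hu0 : u0 ∈ H10 Ω) (huc : uc ∈ H2 Ω) (huc_boundary : NonposOnBoundary uc)
    (hH1 : ∀ᵐ x ∂volume.restrict Ω, uc x < u0 x)
    (hH2 : ∀ᵐ x ∂volume.restrict Ω, laplacian uc x + f x ≤ 0)
    (u : ℝ → L2 Ω) (hu : SolvesDegenerate T f uc u0 u) :
    (∀ t ∈ Icc 0 T, u t ∈ obstacleSet uc) ∧
    SolvesObstacle T f uc u0 u ∧
    SolvesComplementarity T f uc u0 u ∧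
    (∀ w : ℝ → L2 Ω, SolvesObstacle T f uc u0 w → ∀ t ∈ Icc 0 T, u t = w t) ∧
    (∀ w : ℝ → L2 Ω, SolvesComplementarity T f uc u0 w → ∀ t ∈ Icc 0 T, u t = w t) ∧
    (∀ v : ℝ → L2 Ω, SolvesDegenerate T f uc u0 v → ∀ t ∈ Icc 0 T, u t = v t) := by
  have h0 : ∀ᵐ x ∂volume.restrict Ω, uc x ≤ u0 x := hH1.mono fun x hx => hx.le
  have hK : u0 ∈ obstacleSet uc := ⟨hu0, h0⟩
  have hDC : ∀ v, SolvesDegenerate T f uc u0 v → SolvesComplementarity T f uc u0 v :=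
    fun v hv => hv.solvesComplementarity hΩ.isOpen huc h0 hH2
  have huO := (hDC u hu).solvesObstacle hK
  refine ⟨fun t ht => ⟨?_, hu.obstacle_le h0 ht⟩, huO, hDC u hu, fun w hw t ht => huO.unique hw ht,
    fun w hw t ht => huO.unique (hw.solvesObstacle hK) ht,
    fun v hv t ht => huO.unique ((hDC v hv).solvesObstacle hK) ht⟩
  obtain ⟨hmem, ut, hut, -, hinit⟩ := hu
  exact mem_H10_of_hasTimeDeriv hΩ.isOpen hmem hut (hinit ▸ hu0) ht
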